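/- Let $\mathbf R$ be a finite set of relation symbols and $\mathbf X$ a finite set of variables. Each variable $Z$ has the domain $D_Z=[n_Z]=\{1,\dots,n_Z\}$, and for $\mathbf Y\subseteq\mathbf X$ put $D_{\mathbf Y}=\prod_{Z\in\mathbf Y}D_Z$. Let $Q(\mathbf X)=\Join_{R\in\mathbf R}R(\mathbf X_R)$ be a full conjunctive query, where $\emptyset\ne\mathbf X_R\subseteq\mathbf X$ for every $R$. Assume that $Q$ is Berge-acyclic, i.e. that its incidence graph (the bipartite graph on $\mathbf R\cup\mathbf X$ with an edge between $R$ and $Z$ whenever $Z\in\mathbf X_R$) contains no cycle; in particular this holds if the incidence graph is a tree. Under bag semantics, an instance of $R$ is a tensor $M^{(R)}\in\mathbb R^{D_{\mathbf X_R}}$ of tuple multiplicities, and the size of the output of $Q$ on instances $(M^{(R)})_{R\in\mathbf R}$ is $$|Q|\big((M^{(R)})_R\big)=\sum_{x\in D_{\mathbf X}}\ \prod_{R\in\mathbf R}M^{(R)}_{\pi_{\mathbf X_R}(x)},$$ where $\pi_{\mathbf X_R}(x)$ is the restriction of $x$ to $\mathbf X_R$. For every $R$ and every $Z\in\mathbf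 X_R$ let $f^{(R,Z)}\in\mathbb R^{[n_Z]}$ be a non-negative, non-increasing vector (a degree sequence), and let $B^{(R)}\in[0,\infty]$ (a max tuple multiplicity). For a non-empty set of variables $\mathbf Y\subseteq\mathbf X$, degree sequences $f=(f^{(Z)})_{Z\in\mathbf Y}$ and $B\in[0,\infty]$, let $\mathcal M^+_{f,B}$ be the set of tensors $M\in\mathbb R^{D_{\mathbf Y}}$ such that $0\le M_t\le B$ for all $t\in D_{\mathbf Y}$, and $\sum_{t\in D_{\mathbf Y},\,t_Z=i}M_t\le f^{(Z)}_i$ for all $Z\in\mathbf Y$ and $i\in[n_Z]$. Define the value tensor $V^{f,B}\in\mathbb R^{D_{\mathbf Y}}$ by $$V^{f,B}_m=\max\Big\{\sum_{s\le m}M_s \;:\; M\in\mathcal M^+_{f,B}\Big\}\qquad(m\in D_{\mathbf Y}),$$ where $\le$ is the componentwise order. Define the worst-case tensor $C^{f,B}=\big(\prod_{Z\in\mathbf Y}\Delta_Z\big)V^{f,B}$, where the commuting operators $\Delta_Z$ are the discrete derivatives $(\Delta_Z T)_t=T_t-T_{t'}$; here $t'$ is $t$ with its $Z$-coordinate decreased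 by one, and $T_{t'}$ is read as $0$ if $t_Z=1$. With $f^{(R)}=(f^{(R,Z)})_{Z\in\mathbf X_R}$, the degree sequence bound is $$DSB(Q)=|Q|\big((C^{f^{(R)},B^{(R)}})_R\big).$$ For a tuple of permutations $\sigma=(\sigma_Z)_{Z\in\mathbf Y}$ of the domains $D_Z$, let $M\circ\sigma$ be the tensor $(M\circ\sigma)_t=M_{(\sigma_Z(t_Z))_{Z\in\mathbf Y}}$. Then: 1. For all tensors $M^{(R)}\in\mathcal M^+_{f^{(R)},B^{(R)}}$ and all tuples of permutations $\sigma^{(R)}$ of the domains $(D_Z)_{Z\in\mathbf X_R}$, $R\in\mathbf R$, one has $$|Q|\big((M^{(R)}\circ\sigma^{(R)})_R\big)\le DSB(Q).$$ 2. If $B^{(R)}=\infty$ for all $R\in\mathbf R$, then $C^{f^{(R)},B^{(R)}}\in\mathcal M^+_{f^{(R)},B^{(R)}}$ for every $R$, and the bound is tight: there are $M^{(R)}\in\mathcal M^+_{f^{(R)},B^{(R)}}$ and $\sigma^{(R)}$, $R\in\mathbf R$, for which equality holds in 1. -/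

import Mathlib

open scoped ENNReal

namespace DegreeSequenceBound

noncomputable section

variable {Var : Type*}

/-- The tuples over the variables in `S`; the variable `Z` has the domain `Fin (n Z)`. -/
abbrev Tup (n : Var → ℕ) (S : Finset Var) : Type _ := (Z : S) → Fin (n Z)

/-- Real tensors whose dimensions are the variables in `S`. -/
abbrev Tensor (n : Var → ℕ) (S : Finset Var) : Type _ := Tup n S → ℝ

variable {n : Var → ℕ} {S : Finset Var}

/-- Sum out all variables of `S` except `Z`, giving a vector indexed by the domain of `Z`. -/
def marginal [DecidableEq Var] (M : Tensor n S) (Z : S) : Fin (n Z) → ℝ :=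
  fun i => ∑ t : Tup n S with t Z = i, M t

/-- A degree sequence: a non-negative, non-increasing vector. -/
def IsDegreeSequence {k : ℕ} (f : Fin k → ℝ) : Prop :=
  (∀ i, 0 ≤ f i) ∧ Antitone f

/-- The non-negative tensors that are consistent with the degree sequences `f` (one for each
variable in `S`) and with the max tuple multiplicity `B`, which may be `∞`. -/
def ConsistentNonneg [DecidableEq Var] (f : (Z : S) → Fin (n Z) → ℝ) (B : ℝ≥0∞) : Set (Tensor n S) :=
  {M | (∀ t, 0 ≤ M t) ∧ (∀ Z i, marginal M Z i ≤ f Z i) ∧ ∀ t, ENNReal.ofReal (M t) ≤ B}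

/-- The tensor `M ∘ σ`, for a tuple `σ` with one permutation for each dimension. -/
def permute (M : Tensor n S) (σ : (Z : S) → Equiv.Perm (Fin (n Z))) : Tensor n S :=
  fun t => M (fun Z => σ Z (t Z))

/-- The discrete derivative along the variable `Z`: the entry at `t` minus the entry at the
tuple whose `Z`-coordinate is one smaller, the latter being `0` if `t Z` is the first index. -/
def diff [DecidableEq Var] (Z : S) (T : Tensor n S) : Tensor n S :=
  fun t => T t - if 0 < (t Z : ℕ) then
    T (Function.update t Z ⟨(t Z : ℕ) - 1, lt_of_le_of_lt (Nat.sub_le _ _) (t Z).isLt⟩) else 0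

/-- Discrete derivatives commute, so they can be iterated over an unordered set of variables. -/
instance diff_leftCommutative [DecidableEq Var] :
    LeftCommutative (diff : S → Tensor n S → Tensor n S) where
  left_comm Z W T := by
    by_cases h : Z = W
    · rw [h]
    · have h' : ¬ W = Z := fun e => h e.symm
      funext t
      simp only [diff, Function.update_of_ne h, Function.update_of_ne h']
      rw [Function.update_comm h]
      split_ifs <;> ring

/-- The value tensor: its entry at `m` is the maximum, over all non-negative consistent tensors,
of the sum of the entries at positions `≤ m` (componentwise order). -/
def valueTensor [DecidableEq Var] (f : (Z : S) → Fin (n Z) → ℝ) (B : ℝ≥0∞) : Tensor n S :=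
  fun m => sSup ((fun M : Tensor n S => ∑ s : Tup n S with ∀ Z, s Z ≤ m Z, M s) ''
    ConsistentNonneg f B)

/-- The worst-case tensor: the iterated discrete derivative of the value tensor along all
variables in `S`. -/
def worstCaseTensor [DecidableEq Var] (f : (Z : S) → Fin (n Z) → ℝ) (B : ℝ≥0∞) : Tensor n S :=
  (Finset.univ : Finset S).val.foldr diff (valueTensor f B)

/-- A full conjunctive query with relation symbols `Rel` and variables `Var`: the join of the
atoms `R (vars R)`, all of whose variables are output variables. -/
structure Query (Rel Var : Type*) where
  /-- the set of variables of each relation -/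
  vars : Rel → Finset Var

namespace Query

variable {Rel : Type*}

/-- The incidence graph: the bipartite graph on relations and variables in which `R` is joined
to `Z` when `Z` is a variable of `R`. -/
def incidenceGraph (Q : Query Rel Var) : SimpleGraph (Rel ⊕ Var) where
  Adj
    | .inl R, .inr Z => Z ∈ Q.vars R
    | .inr Z, .inl R => Z ∈ Q.vars R
    | _, _ => False
  symm := ⟨by rintro (R | Z) (R' | Z') h <;> exact h⟩
  loopless := ⟨by rintro (R | Z) h <;> exact h⟩

/-- A query is Berge-acyclic if it has no Berge cycle, that is, if its incidence graph has no
cycle. Every query whose incidence graph is a tree is Berge-acyclic. -/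
def BergeAcyclic (Q : Query Rel Var) : Prop := Q.incidenceGraph.IsAcyclic

variable [Fintype Rel] [Fintype Var] [DecidableEq Var]

/-- The output size of the query under bag semantics, when the instance of each relation `R` is
given by the tensor `M R` of tuple multiplicities: the sum over all tuples `x` of the product
of the entries at the projections of `x`. -/
def outputSize (Q : Query Rel Var) (M : (R : Rel) → Tensor n (Q.vars R)) : ℝ :=
  ∑ x : (Z : Var) → Fin (n Z), ∏ R, M R (fun Z => x Z)

/-- The degree sequence bound: the query evaluated on the worst-case tensors. -/
def DSB (Q : Query Rel Var) (f : (R : Rel) → (Z : Q.vars R) → Fin (n Z) → ℝ)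
    (B : Rel → ℝ≥0∞) : ℝ :=
  Q.outputSize (fun R => worstCaseTensor (f R) (B R))

end Query

end

end DegreeSequenceBound

/-!
The proof compares tensors through their sums over combinatorial boxes `∏ Z, S Z`. A tensor `C`
*majorizes* `T` if the sum of `T` over any box is at most the sum of `C` over the box of the same
side lengths anchored at the origin, and `C` is *sorted* if its one-dimensional marginals on
origin-anchored boxes are non-negative and non-increasing.

The sums of the worst-case tensor over origin-anchored boxes are the values of the value tensor
(`boxSum_worstCaseTensor`), because the discrete derivatives telescope. Hence the worst-case tensor
majorizes every permutation of every consistent tensor `M`: the part of `M` in a box can be moved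
to the origin, which keeps it consistent as degree sequences are non-increasing
(`boxSum_le_maxPrefix`). It is sorted because the value tensor is monotone, and concave in each
direction (`maxPrefix_concave`): averaging tensors that are optimal for the lengths `z` and `z + 2`
and merging the slice at the last index into its predecessor gives a consistent tensor for the
length `z + 1`. The worst-case tensor may have negative entries, but this is never an obstacle, as
only the marginals of sorted tensors are used.

Both properties pass to joins over at most one variable (`Majorizes.mul`, `IsSorted.mul`). On a
slice orthogonal to the shared variable the two factors are independent, so a sum of the join over
a box is, up to a factor, the scalar product of two marginal vectors; such products are compared by
summation by parts. An acyclic incidence graph has a relation that shares at most one variable with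
the others (`Query.BergeAcyclic.exists_ear`), so by induction the join of the worst-case tensors
majorizes the join of the permuted instances. Taking the full box gives the bound.

Without a bound on the multiplicities, the value at a box is the minimum over the variables of the
partial sums of the degree sequences, that is, the length of an intersection of intervals starting
at `0`. The tensor of the lengths of the intersections of the intervals between consecutive partial
sums is consistent and attains all these values at once, so it is the worst-case tensor
(`worstCaseTensor_top`), and the bound is attained by the worst-case tensors themselves.
-/

namespace DegreeSequenceBound

open Finset Function

/-! ### Initial segments and summation by parts -/

/-- The first `k` elements of `Fin m` (all of them if `m ≤ k`). -/
def initSeg {m : ℕ} (k : ℕ) : Finset (Fin m) := univ.filter fun i => (i : ℕ) < k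

@[simp] lemma mem_initSeg {m k : ℕ} {i : Fin m} : i ∈ initSeg k ↔ (i : ℕ) < k := by
  simp [initSeg]

lemma card_initSeg {m k : ℕ} (h : k ≤ m) : #(initSeg k : Finset (Fin m)) = k := by
  have : (initSeg k : Finset (Fin m)).map Fin.valEmbedding = range k := by
    ext j
    simp only [mem_map, mem_initSeg, Fin.valEmbedding_apply, mem_range]
    exact ⟨by rintro ⟨a, ha, rfl⟩; exact ha, fun hj => ⟨⟨j, hj.trans_le h⟩, hj, rfl⟩⟩
  rw [← card_map, this, card_range]

lemma initSeg_zero {m : ℕ} : (initSeg 0 : Finset (Fin m)) = ∅ := by ext; simp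

lemma initSeg_succ {m k : ℕ} (h : k < m) :
    (initSeg (k + 1) : Finset (Fin m)) = insert ⟨k, h⟩ (initSeg k) := by
  ext i; simp only [mem_initSeg, mem_insert, Fin.ext_iff]; omega

lemma initSeg_of_le {m k : ℕ} (h : m ≤ k) : (initSeg k : Finset (Fin m)) = univ := by
  ext i; simp only [mem_initSeg, mem_univ, iff_true]; omega

lemma initSeg_one {m : ℕ} (z : Fin m) (hz : (z : ℕ) = 0) : (initSeg 1 : Finset (Fin m)) = {z} := by
  ext i; simp only [mem_initSeg, mem_singleton, Fin.ext_iff]; omega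

lemma sum_initSeg_succ {m k : ℕ} (h : k < m) (g : Fin m → ℝ) :
    ∑ i ∈ initSeg (k + 1), g i = ∑ i ∈ initSeg k, g i + g ⟨k, h⟩ := by
  rw [initSeg_succ h, sum_insert (by simp), add_comm]

/-- Summation by parts: if the prefix sums of `a` are bounded by those of `b`, this remains so
after multiplying both by a non-negative, non-increasing vector. -/
lemma sum_mul_le_sum_mul_of_prefix {m : ℕ} {a b c : Fin m → ℝ} (hc0 : ∀ i, 0 ≤ c i)
    (hc : Antitone c) (h : ∀ j, ∑ i ∈ initSeg j, a i ≤ ∑ i ∈ initSeg j, b i) (k : ℕ) :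
    ∑ i ∈ initSeg k, a i * c i ≤ ∑ i ∈ initSeg k, b i * c i := by
  -- any lower bound `γ` of the weights may be pulled out of the sum of the differences
  have key : ∀ k, ∀ γ : ℝ, (∀ i ∈ (initSeg k : Finset (Fin m)), γ ≤ c i) →
      γ * ∑ i ∈ initSeg k, (b i - a i) ≤ ∑ i ∈ initSeg k, (b i - a i) * c i := by
    intro k
    induction k with
    | zero => intro γ _; simp [initSeg_zero]
    | succ k ih =>
      intro γ hγ
      by_cases hk : k < m
      · have h1 := ih (c ⟨k, hk⟩) fun i hi => hc (by
          rw [Fin.le_def]; exact (mem_initSeg.1 hi).le)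
        have h2 : γ ≤ c ⟨k, hk⟩ := hγ _ (by simp)
        have h3 : 0 ≤ ∑ i ∈ initSeg (k + 1), (b i - a i) := by
          rw [sum_sub_distrib]; linarith [h (k + 1)]
        have h4 := mul_le_mul_of_nonneg_right h2 h3
        refine h4.trans ?_
        rw [sum_initSeg_succ hk, sum_initSeg_succ hk]
        linarith
      · have e : (initSeg (k + 1) : Finset (Fin m)) = initSeg k := by
          rw [initSeg_of_le (by omega), initSeg_of_le (by omega)]
        rw [e] at hγ ⊢
        exact ih γ hγ
  have := key k 0 fun i _ => hc0 i
  simp only [sub_mul, sum_sub_distrib] at this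
  linarith

lemma sum_initSeg_castLE {s m : ℕ} (hs : s ≤ m) (g : Fin m → ℝ) (j : ℕ) :
    ∑ i ∈ (initSeg j : Finset (Fin s)), g (Fin.castLE hs i) =
      ∑ i ∈ initSeg #(initSeg j : Finset (Fin s)), g i := by
  have : (initSeg #(initSeg j : Finset (Fin s)) : Finset (Fin m)) =
      (initSeg j : Finset (Fin s)).map (Fin.castLEEmb hs) := by
    have hcard : #(initSeg j : Finset (Fin s)) = min j s := by
      rcases le_total j s with h | h
      · rw [card_initSeg h, min_eq_left h]
      · rw [initSeg_of_le h, min_eq_right h, card_univ, Fintype.card_fin]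
    ext i
    simp only [hcard, mem_initSeg, mem_map, lt_min_iff, Fin.castLEEmb_apply]
    constructor
    · rintro ⟨h1, h2⟩
      exact ⟨⟨i, h2⟩, h1, rfl⟩
    · rintro ⟨i, hi, rfl⟩
      exact ⟨hi, i.2⟩
  rw [this, sum_map]
  rfl

/-- Weak majorization is preserved by products: if all subset sums of `G` and of `H` are bounded
by the prefix sums of the sorted vectors `G'` and `H'`, the same holds for the products. -/
lemma sum_mul_le_of_majorized {m : ℕ} {G H G' H' : Fin m → ℝ} (S : Finset (Fin m))
    (hH : ∀ i, 0 ≤ H i)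
    (hG'0 : ∀ i, 0 ≤ G' i) (hG' : Antitone G')
    (hGG : ∀ U ⊆ S, ∑ i ∈ U, G i ≤ ∑ i ∈ initSeg #U, G' i)
    (hHH : ∀ U ⊆ S, ∑ i ∈ U, H i ≤ ∑ i ∈ initSeg #U, H' i) :
    ∑ i ∈ S, G i * H i ≤ ∑ i ∈ initSeg #S, G' i * H' i := by
  have hs : #S ≤ m := by simpa using card_le_univ S
  obtain ⟨e, he, heS, hanti⟩ : ∃ e : Fin #S → Fin m, Injective e ∧ univ.image e = S ∧
      Antitone (H ∘ e) := by
    let e₀ : Fin #S → Fin m := fun i => S.equivFin.symm i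
    have he₀ : Injective e₀ := Subtype.val_injective.comp S.equivFin.symm.injective
    let τ := Tuple.sort (fun i => -H (e₀ i))
    have hτ := Tuple.monotone_sort (fun i => -H (e₀ i))
    refine ⟨e₀ ∘ τ, he₀.comp τ.injective, ?_, ?_⟩
    · refine eq_of_subset_of_card_le ?_ ?_
      · intro i hi
        obtain ⟨j, -, rfl⟩ := mem_image.1 hi
        exact (S.equivFin.symm (τ j)).2
      · rw [card_image_of_injective _ (he₀.comp τ.injective)]; simp
    · intro i j hij
      have := hτ hij
      simpa using this
  have hsum : ∀ (g : Fin m → ℝ) (A : Finset (Fin #S)), ∑ i ∈ A, g (e i) = ∑ i ∈ A.image e, g i :=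
    fun g A => (sum_image he.injOn).symm
  have hpre : ∀ (g g' : Fin m → ℝ), (∀ U ⊆ S, ∑ i ∈ U, g i ≤ ∑ i ∈ initSeg #U, g' i) →
      ∀ j, ∑ i ∈ (initSeg j : Finset (Fin #S)), g (e i) ≤
        ∑ i ∈ (initSeg j : Finset (Fin #S)), g' (Fin.castLE hs i) := by
    intro g g' hgg j
    rw [hsum, sum_initSeg_castLE hs]
    refine (hgg _ ?_).trans_eq ?_
    · intro i hi
      obtain ⟨j, -, rfl⟩ := mem_image.1 hi
      rw [← heS]
      exact mem_image_of_mem _ (mem_univ _)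
    · rw [card_image_of_injective _ he]
  -- with `e` listing `S` so that `H` is non-increasing, replace `G` by `G'` first and `H` by `H'`
  -- second: the weights `H ∘ e` and `G'` are sorted in the respective step
  have h1 := sum_mul_le_sum_mul_of_prefix (c := fun i => H (e i)) (fun i => hH _) hanti
    (hpre G G' hGG) #S
  have h2 := sum_mul_le_sum_mul_of_prefix (c := fun i => G' (Fin.castLE hs i))
    (fun i => hG'0 _) (fun i j hij => hG' hij) (hpre H H' hHH) #S
  have hl : ∑ i ∈ S, G i * H i = ∑ i ∈ (initSeg #S : Finset (Fin #S)), G (e i) * H (e i) := by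
    rw [initSeg_of_le le_rfl, hsum fun i => G i * H i, heS]
  have hr : ∑ i ∈ initSeg #S, G' i * H' i = ∑ i ∈ (initSeg #S : Finset (Fin #S)),
      G' (Fin.castLE hs i) * H' (Fin.castLE hs i) := by
    rw [sum_initSeg_castLE hs fun i => G' i * H' i, card_initSeg le_rfl]
  rw [hl, hr]
  refine h1.trans ?_
  simpa only [mul_comm] using h2

/-! ### Sums over boxes -/

section Box

variable {ι : Type*} {n : ι → ℕ}

/-- The sides of the box anchored at the origin with side lengths `k`. -/
def initBox (k : ι → ℕ) : ∀ i, Finset (Fin (n i)) := fun i => initSeg (k i)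

lemma initBox_update [DecidableEq ι] (k : ι → ℕ) (i : ι) (j : ℕ) :
    (initBox (update k i j) : ∀ i, Finset (Fin (n i))) = update (initBox k) i (initSeg j) := by
  funext l
  rcases eq_or_ne l i with rfl | h <;> simp [initBox, *]

lemma card_initBox_card (S : ∀ i, Finset (Fin (n i))) (i : ι) :
    #(initBox (fun l => #(S l)) i : Finset (Fin (n i))) = #(S i) :=
  card_initSeg (by simpa using card_le_univ (S i))

/-- The tensor `T` over the variables in `Y`, as a function of the tuples over all variables. -/
def extend {Y : Finset ι} (T : Tensor n Y) : (∀ i, Fin (n i)) → ℝ := fun x => T fun i => x i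

lemma dependsOn_extend {Y : Finset ι} (T : Tensor n Y) : DependsOn (extend T) (Y : Set ι) :=
  fun _ _ h => congrArg T (funext fun i => h i i.2)

variable [Fintype ι] [DecidableEq ι]

/-- The sum of the entries of a tensor over the box `∏ i, S i`. -/
def boxSum (T : (∀ i, Fin (n i)) → ℝ) (S : ∀ i, Finset (Fin (n i))) : ℝ :=
  ∑ x ∈ Fintype.piFinset S, T x

lemma boxSum_nonneg {T : (∀ i, Fin (n i)) → ℝ} (hT : ∀ x, 0 ≤ T x)
    (S : ∀ i, Finset (Fin (n i))) : 0 ≤ boxSum T S := sum_nonneg fun x _ => hT x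

lemma boxSum_mono {T : (∀ i, Fin (n i)) → ℝ} (hT : ∀ x, 0 ≤ T x)
    {S S' : ∀ i, Finset (Fin (n i))} (h : ∀ i, S i ⊆ S' i) : boxSum T S ≤ boxSum T S' :=
  sum_le_sum_of_subset_of_nonneg (Fintype.piFinset_subset _ _ h) fun x _ _ => hT x

lemma boxSum_update_eq_sum (T : (∀ i, Fin (n i)) → ℝ) (S : ∀ i, Finset (Fin (n i))) (i : ι)
    (A : Finset (Fin (n i))) :
    boxSum T (update S i A) = ∑ z ∈ A, boxSum T (update S i {z}) := by
  unfold boxSum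
  rw [← sum_fiberwise_of_maps_to (t := A) (g := fun x => x i)]
  · refine sum_congr rfl fun z hz => sum_congr ?_ fun _ _ => rfl
    ext x
    simp only [mem_filter, Fintype.mem_piFinset]
    constructor
    · rintro ⟨h, rfl⟩ l
      rcases eq_or_ne l i with rfl | hl
      · simp
      · simpa [hl] using h l
    · intro h
      have hi : x i = z := by simpa using h i
      refine ⟨fun l => ?_, hi⟩
      rcases eq_or_ne l i with rfl | hl
      · simpa [hi] using hz
      · simpa [hl] using h l
  · intro x hx
    simpa using Fintype.mem_piFinset.1 hx i

lemma boxSum_eq_sum_slice (T : (∀ i, Fin (n i)) → ℝ) (S : ∀ i, Finset (Fin (n i))) (i : ι) :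
    boxSum T S = ∑ z ∈ S i, boxSum T (update S i {z}) := by
  rw [← boxSum_update_eq_sum, update_eq_self]

/-- The points of a slice are obtained from those of a parallel slice by changing one coordinate. -/
lemma boxSum_update_singleton_shift (T : (∀ i, Fin (n i)) → ℝ) (S : ∀ i, Finset (Fin (n i)))
    (i : ι) (w w' : Fin (n i)) :
    boxSum (fun x => T (update x i w')) (update S i {w}) = boxSum T (update S i {w'}) := by
  unfold boxSum
  have aux : ∀ (v v' : Fin (n i)) (x : ∀ i, Fin (n i)), x ∈ Fintype.piFinset (update S i {v}) →
      update x i v' ∈ Fintype.piFinset (update S i {v'}) := by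
    intro v v' x hx
    rw [Fintype.mem_piFinset] at hx ⊢
    intro l
    rcases eq_or_ne l i with rfl | hl
    · simp
    · simpa [hl] using hx l
  have aux2 : ∀ (v v' : Fin (n i)) (x : ∀ i, Fin (n i)), x ∈ Fintype.piFinset (update S i {v}) →
      update (update x i v') i v = x := by
    intro v v' x hx
    have : x i = v := by simpa using Fintype.mem_piFinset.1 hx i
    rw [update_idem, ← this, update_eq_self]
  exact sum_nbij' (fun x => update x i w') (fun x => update x i w) (aux w w') (aux w' w)
    (aux2 w w') (aux2 w' w) fun x _ => rfl

/-- The slices in a direction on which the tensor does not depend are all equal. -/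
lemma boxSum_update_singleton_eq {T : (∀ i, Fin (n i)) → ℝ} {Y : Set ι} (hT : DependsOn T Y)
    {i : ι} (hi : i ∉ Y) (S : ∀ i, Finset (Fin (n i))) (w w' : Fin (n i)) :
    boxSum T (update S i {w}) = boxSum T (update S i {w'}) := by
  rw [← boxSum_update_singleton_shift T S i w w']
  refine sum_congr rfl fun x _ => hT fun l hl => ?_
  rw [update_of_ne (by rintro rfl; exact hi hl)]

/-- On a box, a tensor that depends on the coordinates in `A` and one that depends on those
outside `A` are independent. -/
lemma card_mul_sum_mul {S : ∀ i, Finset (Fin (n i))} {g h : (∀ i, Fin (n i)) → ℝ} (A : Set ι)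
    [∀ i, Decidable (i ∈ A)]
    (hg : ∀ x ∈ Fintype.piFinset S, ∀ y ∈ Fintype.piFinset S, g (A.piecewise x y) = g x)
    (hh : ∀ x ∈ Fintype.piFinset S, ∀ y ∈ Fintype.piFinset S, h (A.piecewise x y) = h y) :
    #(Fintype.piFinset S) * boxSum (fun x => g x * h x) S = boxSum g S * boxSum h S := by
  unfold boxSum
  rw [sum_mul_sum, ← nsmul_eq_mul, ← sum_const, ← sum_product', ← sum_product']
  have hmem : ∀ x ∈ Fintype.piFinset S, ∀ y ∈ Fintype.piFinset S,
      A.piecewise x y ∈ Fintype.piFinset S := by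
    intro x hx y hy
    rw [Fintype.mem_piFinset] at *
    intro i
    by_cases hi : i ∈ A <;> simp [hi, hx i, hy i]
  -- exchanging the coordinates in `A` is an involution on the pairs of points of the box
  refine sum_nbij' (fun p => (A.piecewise p.2 p.1, A.piecewise p.1 p.2))
    (fun p => (A.piecewise p.2 p.1, A.piecewise p.1 p.2)) ?_ ?_ ?_ ?_ ?_
  · rintro ⟨x, y⟩ hp
    rw [mem_product] at hp ⊢
    exact ⟨hmem _ hp.2 _ hp.1, hmem _ hp.1 _ hp.2⟩
  · rintro ⟨x, y⟩ hp
    rw [mem_product] at hp ⊢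
    exact ⟨hmem _ hp.2 _ hp.1, hmem _ hp.1 _ hp.2⟩
  · rintro ⟨x, y⟩ -
    ext i <;> by_cases hi : i ∈ A <;> simp [hi]
  · rintro ⟨x, y⟩ -
    ext i <;> by_cases hi : i ∈ A <;> simp [hi]
  · rintro ⟨x, y⟩ hp
    rw [mem_product] at hp
    simp only
    rw [hg _ hp.2 _ hp.1, hh _ hp.1 _ hp.2]

end Box

section Join

variable {ι : Type*} [Fintype ι] [DecidableEq ι] {n : ι → ℕ}

/-- The number of points of a slice orthogonal to the direction `i` of the box with sides `S`. -/
def sliceCard (S : ∀ i, Finset (Fin (n i))) (i : ι) : ℝ :=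
  ∏ j, update (fun l => (#(S l) : ℝ)) i 1 j

lemma card_slice (S : ∀ i, Finset (Fin (n i))) (i : ι) (z : Fin (n i)) :
    (#(Fintype.piFinset (update S i {z})) : ℝ) = sliceCard S i := by
  rw [Fintype.card_piFinset, Nat.cast_prod, sliceCard]
  refine prod_congr rfl fun j _ => ?_
  rcases eq_or_ne j i with rfl | h <;> simp [*]

lemma sliceCard_nonneg (S : ∀ i, Finset (Fin (n i))) (i : ι) : 0 ≤ sliceCard S i := by
  refine prod_nonneg fun j _ => ?_
  rcases eq_or_ne j i with rfl | h <;> simp [*]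

lemma sliceCard_congr {S S' : ∀ i, Finset (Fin (n i))} (h : ∀ i, #(S i) = #(S' i)) (i : ι) :
    sliceCard S i = sliceCard S' i := by
  simp only [sliceCard, h]

lemma sliceCard_initBox_card (S : ∀ i, Finset (Fin (n i))) (i : ι) :
    sliceCard (initBox (fun l => #(S l)) : ∀ i, Finset (Fin (n i))) i = sliceCard S i :=
  sliceCard_congr (card_initBox_card S) i

/-- If two tensors share at most the variable `i`, they are independent on every slice orthogonal
to `i`. If the slice is empty, both sides vanish, the right one because `0⁻¹ = 0`. -/
lemma boxSum_mul_slice {T₁ T₂ : (∀ i, Fin (n i)) → ℝ} {Y₁ Y₂ : Set ι} (h₁ : DependsOn T₁ Y₁)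
    (h₂ : DependsOn T₂ Y₂) {i : ι} (hY : Y₁ ∩ Y₂ ⊆ {i}) (S : ∀ i, Finset (Fin (n i)))
    (z : Fin (n i)) :
    boxSum (fun x => T₁ x * T₂ x) (update S i {z}) =
      (sliceCard S i)⁻¹ * (boxSum T₁ (update S i {z}) * boxSum T₂ (update S i {z})) := by
  classical
  have key := card_mul_sum_mul (S := update S i {z}) (g := T₁) (h := T₂) Y₁
    (fun x _ y _ => h₁ fun l hl => by simp [hl]) (fun x hx y hy => h₂ fun l hl => by
      by_cases hl1 : l ∈ Y₁
      · obtain rfl : l = i := hY ⟨hl1, hl⟩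
        have hx' : x l = z := by simpa using Fintype.mem_piFinset.1 hx l
        have hy' : y l = z := by simpa using Fintype.mem_piFinset.1 hy l
        simp [hl1, hx', hy']
      · simp [hl1])
  rw [card_slice] at key
  by_cases h0 : sliceCard S i = 0
  · have : Fintype.piFinset (update S i {z}) = ∅ := by
      rw [← card_eq_zero, ← Nat.cast_eq_zero (R := ℝ), card_slice, h0]
    simp [boxSum, this]
  · rw [← key, inv_mul_cancel_left₀ h0]

lemma boxSum_mul {T₁ T₂ : (∀ i, Fin (n i)) → ℝ} {Y₁ Y₂ : Set ι} (h₁ : DependsOn T₁ Y₁)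
    (h₂ : DependsOn T₂ Y₂) {i : ι} (hY : Y₁ ∩ Y₂ ⊆ {i}) (S : ∀ i, Finset (Fin (n i))) :
    boxSum (fun x => T₁ x * T₂ x) S = (sliceCard S i)⁻¹ *
      ∑ z ∈ S i, boxSum T₁ (update S i {z}) * boxSum T₂ (update S i {z}) := by
  rw [boxSum_eq_sum_slice _ _ i, mul_sum]
  exact sum_congr rfl fun z _ => boxSum_mul_slice h₁ h₂ hY S z

/-! ### Sorted tensors and majorization, and their behaviour under joins -/

/-- A tensor is sorted if, summing over an initial segment in all directions but one, one gets a
non-negative and non-increasing vector. The entries themselves may be negative. -/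
def IsSorted (C : (∀ i, Fin (n i)) → ℝ) : Prop :=
  ∀ (k : ι → ℕ) (i : ι), (∀ z, 0 ≤ boxSum C (update (initBox k) i {z})) ∧
    Antitone fun z => boxSum C (update (initBox k) i {z})

/-- `C` majorizes `T` if the sum of `T` over any combinatorial box is at most the sum of `C` over
the box of the same side lengths anchored at the origin. -/
def Majorizes (C T : (∀ i, Fin (n i)) → ℝ) : Prop :=
  ∀ S : ∀ i, Finset (Fin (n i)), boxSum T S ≤ boxSum C (initBox fun i => #(S i))

lemma Majorizes.sum_slice_le {C T : (∀ i, Fin (n i)) → ℝ} (h : Majorizes C T)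
    (S : ∀ i, Finset (Fin (n i))) (i : ι) (U : Finset (Fin (n i))) :
    ∑ z ∈ U, boxSum T (update S i {z}) ≤
      ∑ z ∈ initSeg #U, boxSum C (update (initBox fun l => #(S l)) i {z}) := by
  rw [← boxSum_update_eq_sum, ← boxSum_update_eq_sum, ← initBox_update]
  convert h (update S i U) using 3
  funext l
  rcases eq_or_ne l i with rfl | hl <;> simp [*]

/-- Majorization by sorted tensors is preserved by a join over at most one variable. -/
lemma Majorizes.mul {T₁ T₂ C₁ C₂ : (∀ i, Fin (n i)) → ℝ} {Y₁ Y₂ : Set ι}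
    (hT₁ : DependsOn T₁ Y₁) (hT₂ : DependsOn T₂ Y₂) (hC₁ : DependsOn C₁ Y₁)
    (hC₂ : DependsOn C₂ Y₂) {i : ι} (hY : Y₁ ∩ Y₂ ⊆ {i}) (hnn : ∀ x, 0 ≤ T₂ x)
    (hs₁ : IsSorted C₁) (h₁ : Majorizes C₁ T₁) (h₂ : Majorizes C₂ T₂) :
    Majorizes (fun x => C₁ x * C₂ x) (fun x => T₁ x * T₂ x) := by
  intro S
  rw [boxSum_mul hT₁ hT₂ hY, boxSum_mul hC₁ hC₂ hY, sliceCard_initBox_card]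
  refine mul_le_mul_of_nonneg_left ?_ (inv_nonneg.2 (sliceCard_nonneg S i))
  exact sum_mul_le_of_majorized (S i) (fun z => boxSum_nonneg hnn _) (hs₁ _ i).1 (hs₁ _ i).2
    (fun U _ => h₁.sum_slice_le S i U) (fun U _ => h₂.sum_slice_le S i U)

/-- The slices of a join in a direction `w` that occurs in the first factor only: summation by
parts against the vector contributed by the second factor. -/
lemma IsSorted.mul_aux {C₁ C₂ : (∀ i, Fin (n i)) → ℝ} {Y₁ Y₂ : Set ι} (hC₁ : DependsOn C₁ Y₁)
    (hC₂ : DependsOn C₂ Y₂) {i : ι} (hY : Y₁ ∩ Y₂ ⊆ {i}) (hs₁ : IsSorted C₁) (hs₂ : IsSorted C₂)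
    (k : ι → ℕ) {w : ι} (hw : w ∉ Y₂) (hwi : w ≠ i) :
    (∀ z, 0 ≤ boxSum (fun x => C₁ x * C₂ x) (update (initBox k) w {z})) ∧
      Antitone fun z => boxSum (fun x => C₁ x * C₂ x) (update (initBox k) w {z}) := by
  have key : ∀ z z₀ : Fin (n w), (z₀ : ℕ) = 0 →
      boxSum (fun x => C₁ x * C₂ x) (update (initBox k) w {z}) =
        (sliceCard (update (initBox k) w {z₀} : ∀ i, Finset (Fin (n i))) i)⁻¹ *
          ∑ y ∈ initSeg (k i), boxSum C₁ (update (update (initBox k) w {z}) i {y}) *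
            boxSum C₂ (update (initBox (update k w 1)) i {y}) := by
    intro z z₀ hz₀
    rw [boxSum_mul hC₁ hC₂ hY, sliceCard_congr (S' := update (initBox k) w {z₀})]
    · congr 1
      rw [update_of_ne hwi.symm]
      refine sum_congr rfl fun y _ => ?_
      have hc : ∀ v : Fin (n w), (update (update (initBox k) w {v}) i {y} :
          ∀ i, Finset (Fin (n i))) = update (update (initBox k) i {y}) w {v} :=
        fun v => update_comm hwi _ _ _
      rw [initBox_update, initSeg_one z₀ hz₀, hc z₀, ← boxSum_update_singleton_eq hC₂ hw _ z z₀,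
        ← hc z]
    · intro l
      rcases eq_or_ne l w with rfl | hl <;> simp [*]
  have hslice : ∀ (z : Fin (n w)) (j : ℕ),
      ∑ y ∈ initSeg j, boxSum C₁ (update (update (initBox k) w {z}) i {y}) =
        boxSum C₁ (update (initBox (update k i j)) w {z}) := by
    intro z j
    rw [← boxSum_update_eq_sum, initBox_update, update_comm hwi]
  have h2 := hs₂ (update k w 1) i
  constructor
  · intro z
    rw [key z ⟨0, z.pos⟩ rfl]
    refine mul_nonneg (inv_nonneg.2 (sliceCard_nonneg _ _)) ?_
    have := sum_mul_le_sum_mul_of_prefix (a := fun _ => 0) (b := fun y =>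
      boxSum C₁ (update (update (initBox k) w {z}) i {y})) h2.1 h2.2 (fun j => by
        rw [hslice, sum_const_zero]; exact (hs₁ _ w).1 z) (k i)
    simpa using this
  · intro z z' hzz
    simp only
    rw [key z ⟨0, z.pos⟩ rfl, key z' ⟨0, z.pos⟩ rfl]
    refine mul_le_mul_of_nonneg_left ?_ (inv_nonneg.2 (sliceCard_nonneg _ _))
    refine sum_mul_le_sum_mul_of_prefix h2.1 h2.2 (fun j => ?_) (k i)
    rw [hslice, hslice]
    exact (hs₁ _ w).2 hzz

/-- A join of sorted tensors over at most one variable is sorted. -/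
lemma IsSorted.mul {C₁ C₂ : (∀ i, Fin (n i)) → ℝ} {Y₁ Y₂ : Set ι} (hC₁ : DependsOn C₁ Y₁)
    (hC₂ : DependsOn C₂ Y₂) {i : ι} (hY : Y₁ ∩ Y₂ ⊆ {i}) (hs₁ : IsSorted C₁)
    (hs₂ : IsSorted C₂) : IsSorted fun x => C₁ x * C₂ x := by
  intro k w
  rcases eq_or_ne w i with rfl | hwi
  · simp only [boxSum_mul_slice hC₁ hC₂ hY]
    have hN := inv_nonneg.2 (sliceCard_nonneg (initBox k : ∀ i, Finset (Fin (n i))) w)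
    refine ⟨fun z => mul_nonneg hN (mul_nonneg ((hs₁ k w).1 z) ((hs₂ k w).1 z)),
      fun z z' h => mul_le_mul_of_nonneg_left ?_ hN⟩
    exact mul_le_mul ((hs₁ k w).2 h) ((hs₂ k w).2 h) ((hs₂ k w).1 _) ((hs₁ k w).1 _)
  · by_cases hw : w ∈ Y₂
    · have hw1 : w ∉ Y₁ := fun h => hwi (hY ⟨h, hw⟩)
      have := IsSorted.mul_aux hC₂ hC₁ (by rwa [Set.inter_comm]) hs₂ hs₁ k hw1 hwi
      simpa only [mul_comm] using this
    · exact IsSorted.mul_aux hC₁ hC₂ hY hs₁ hs₂ k hw hwi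

lemma isSorted_one : IsSorted fun _ : ∀ i, Fin (n i) => (1 : ℝ) := by
  intro k i
  have h : ∀ z, boxSum (fun _ : ∀ i, Fin (n i) => (1 : ℝ)) (update (initBox k) i {z}) =
      sliceCard (initBox k : ∀ i, Finset (Fin (n i))) i := by
    intro z; rw [← card_slice _ _ z]; simp [boxSum]
  simp only [h]
  exact ⟨fun _ => sliceCard_nonneg _ _, antitone_const⟩

lemma majorizes_one : Majorizes (fun _ : ∀ i, Fin (n i) => (1 : ℝ)) (fun _ => 1) := by
  intro S
  simp only [boxSum, sum_const, Fintype.card_piFinset, card_initBox_card, le_refl]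

/-! ### Viewing a tensor as a function of all variables -/

/-- The number of ways to choose the coordinates outside `Y` in the box with sides `A`. -/
def fiberCard (Y : Finset ι) (A : ∀ i, Finset (Fin (n i))) : ℝ :=
  ∏ i, if i ∈ Y then 1 else (#(A i) : ℝ)

lemma fiberCard_nonneg (Y : Finset ι) (A : ∀ i, Finset (Fin (n i))) : 0 ≤ fiberCard Y A :=
  prod_nonneg fun i _ => by split_ifs <;> simp

lemma fiberCard_congr {Y : Finset ι} {A A' : ∀ i, Finset (Fin (n i))}
    (h : ∀ i ∉ Y, #(A i) = #(A' i)) : fiberCard Y A = fiberCard Y A' :=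
  prod_congr rfl fun i _ => by
    split_ifs with hi
    · rfl
    · rw [h i hi]

lemma boxSum_extend {Y : Finset ι} (T : Tensor n Y) (A : ∀ i, Finset (Fin (n i))) :
    boxSum (extend T) A = fiberCard Y A * boxSum T fun i : Y => A i := by
  unfold boxSum
  rw [← sum_fiberwise_of_maps_to (t := Fintype.piFinset fun i : Y => A i)
    (g := fun (x : ∀ i, Fin (n i)) (i : Y) => x i)
    (fun x hx => Fintype.mem_piFinset.2 fun i => Fintype.mem_piFinset.1 hx i), mul_sum]
  refine sum_congr rfl fun t ht => ?_
  have hfib : {x ∈ Fintype.piFinset A | (fun i : Y => x i) = t} =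
      Fintype.piFinset fun i => if h : i ∈ Y then ({t ⟨i, h⟩} : Finset (Fin (n i))) else A i := by
    ext x
    simp only [mem_filter, Fintype.mem_piFinset]
    constructor
    · rintro ⟨h, rfl⟩ i
      by_cases hi : i ∈ Y
      · simp [hi]
      · simpa [hi] using h i
    · intro h
      have hx : (fun i : Y => x i) = t := funext fun i => by simpa [i.2] using h i
      refine ⟨fun i => ?_, hx⟩
      by_cases hi : i ∈ Y
      · have := Fintype.mem_piFinset.1 ht ⟨i, hi⟩
        rwa [← hx] at this
      · simpa [hi] using h i
  have hval : ∀ x ∈ ({x ∈ Fintype.piFinset A | (fun i : Y => x i) = t} : Finset _),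
      extend T x = T t := fun x hx => congrArg T (mem_filter.1 hx).2
  rw [sum_congr rfl hval, sum_const, nsmul_eq_mul, hfib, Fintype.card_piFinset, Nat.cast_prod]
  congr 1
  refine prod_congr rfl fun i _ => ?_
  by_cases hi : i ∈ Y <;> simp [hi]

lemma Majorizes.extend {Y : Finset ι} {C T : Tensor n Y} (h : Majorizes C T) :
    Majorizes (extend C) (extend T) := by
  intro S
  rw [boxSum_extend, boxSum_extend, fiberCard_congr fun i _ => card_initBox_card S i]
  exact mul_le_mul_of_nonneg_left (h _) (fiberCard_nonneg _ _)

lemma IsSorted.boxSum_initBox_nonneg [Nonempty ι] {C : (∀ i, Fin (n i)) → ℝ} (h : IsSorted C)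
    (k : ι → ℕ) : 0 ≤ boxSum C (initBox k) := by
  rw [boxSum_eq_sum_slice _ _ (Classical.arbitrary ι)]
  exact sum_nonneg fun z _ => (h k _).1 z

lemma IsSorted.extend {Y : Finset ι} (hY : Y.Nonempty) {C : Tensor n Y} (h : IsSorted C) :
    IsSorted (extend C) := by
  have : Nonempty Y := hY.to_subtype
  intro k w
  by_cases hw : w ∈ Y
  · have e : ∀ z, boxSum (DegreeSequenceBound.extend C) (update (initBox k) w {z}) =
        fiberCard Y (initBox k : ∀ i, Finset (Fin (n i))) *
          boxSum C (update (initBox fun i : Y => k i) ⟨w, hw⟩ {z}) := by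
      intro z
      rw [boxSum_extend, fiberCard_congr (A' := initBox k)]
      · congr 2
        funext i
        rcases eq_or_ne i ⟨w, hw⟩ with rfl | hi
        · simp
        · have : (i : ι) ≠ w := fun h => hi (Subtype.ext h)
          simp [hi, this, initBox]
      · intro i hi
        have : i ≠ w := by rintro rfl; exact hi hw
        simp [this]
    simp only [e]
    have h1 := h (fun i : Y => k i) ⟨w, hw⟩
    exact ⟨fun z => mul_nonneg (fiberCard_nonneg _ _) (h1.1 z),
      fun z z' hz => mul_le_mul_of_nonneg_left (h1.2 hz) (fiberCard_nonneg _ _)⟩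
  · refine ⟨fun z => ?_, fun z z' _ =>
      (boxSum_update_singleton_eq (dependsOn_extend C) hw _ _ _).le⟩
    rw [boxSum_extend]
    refine mul_nonneg (fiberCard_nonneg _ _) ?_
    have e : (fun i : Y => update (initBox k) w {z} (i : ι)) = initBox fun i : Y => k i := by
      funext i
      have : (i : ι) ≠ w := by rintro rfl; exact hw i.2
      simp [this, initBox]
    rw [e]
    exact h.boxSum_initBox_nonneg _

end Join

/-! ### The value tensor and its discrete derivative -/

section Value

variable {Var : Type*} [DecidableEq Var] {n : Var → ℕ} {Y : Finset Var}

/-- The maximal sum over the box of side lengths `k` of a consistent tensor: the value tensor,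
extended by zero to boxes with an empty side. -/
noncomputable def maxPrefix (f : (Z : Y) → Fin (n Z) → ℝ) (B : ℝ≥0∞) (k : Y → ℕ) : ℝ :=
  sSup ((fun M : Tensor n Y => boxSum M (initBox k)) '' ConsistentNonneg f B)

lemma marginal_eq_boxSum (M : Tensor n Y) (Z : Y) (i : Fin (n Z)) :
    marginal M Z i = boxSum M (update (fun _ => univ) Z {i}) := by
  unfold marginal boxSum
  refine sum_congr ?_ fun _ _ => rfl
  ext t
  simp only [mem_filter, mem_univ, true_and, Fintype.mem_piFinset]
  constructor
  · rintro rfl W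
    rcases eq_or_ne W Z with rfl | h <;> simp [*]
  · intro h
    simpa using h Z

variable {f : (Z : Y) → Fin (n Z) → ℝ} {B : ℝ≥0∞}

lemma boxSum_le_sum_of_consistent {M : Tensor n Y} (hM : M ∈ ConsistentNonneg f B)
    (Z : Y) (A : (Z : Y) → Finset (Fin (n Z))) : boxSum M A ≤ ∑ i ∈ A Z, f Z i := by
  rw [boxSum_eq_sum_slice _ _ Z]
  refine sum_le_sum fun i _ => le_trans ?_ (hM.2.1 Z i)
  rw [marginal_eq_boxSum]
  refine boxSum_mono hM.1 fun W => ?_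
  rcases eq_or_ne W Z with rfl | h <;> simp [*]

/-- The degree sequence of a single variable bounds the total sum; without variables and without a
multiplicity bound the supremum would be infinite. -/
lemma bddAbove_maxPrefix (hY : Y.Nonempty) (hf : ∀ Z i, 0 ≤ f Z i) (k : Y → ℕ) :
    BddAbove ((fun M : Tensor n Y => boxSum M (initBox k)) '' ConsistentNonneg f B) := by
  obtain ⟨Z, hZ⟩ := hY
  refine ⟨∑ i, f ⟨Z, hZ⟩ i, ?_⟩
  rintro _ ⟨M, hM, rfl⟩
  exact (boxSum_le_sum_of_consistent hM ⟨Z, hZ⟩ _).trans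
    (sum_le_sum_of_subset_of_nonneg (subset_univ _) fun i _ _ => hf _ i)

lemma le_maxPrefix (hY : Y.Nonempty) (hf : ∀ Z i, 0 ≤ f Z i) {M : Tensor n Y}
    (hM : M ∈ ConsistentNonneg f B) (k : Y → ℕ) : boxSum M (initBox k) ≤ maxPrefix f B k :=
  le_csSup (bddAbove_maxPrefix hY hf k) ⟨M, hM, rfl⟩

/-- The zero tensor is consistent, so the supremum is over a non-empty set. -/
lemma maxPrefix_le (hf : ∀ Z i, 0 ≤ f Z i) {k : Y → ℕ} {c : ℝ}
    (h : ∀ M ∈ ConsistentNonneg f B, boxSum M (initBox k) ≤ c) : maxPrefix f B k ≤ c := by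
  refine csSup_le (Set.Nonempty.image _ ⟨0, fun _ => le_rfl, fun Z i => ?_, fun _ => ?_⟩) ?_
  · simpa [marginal] using hf Z i
  · simp
  · rintro _ ⟨M, hM, rfl⟩
    exact h M hM

lemma maxPrefix_mono (hY : Y.Nonempty) (hf : ∀ Z i, 0 ≤ f Z i) {k k' : Y → ℕ} (h : k ≤ k') :
    maxPrefix f B k ≤ maxPrefix f B k' :=
  maxPrefix_le hf fun _ hM => (boxSum_mono hM.1 fun Z _ hi =>
    mem_initSeg.2 ((mem_initSeg.1 hi).trans_le (h Z))).trans (le_maxPrefix hY hf hM k')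

lemma valueTensor_eq_maxPrefix (m : Tup n Y) :
    valueTensor f B m = maxPrefix f B fun Z => (m Z : ℕ) + 1 := by
  unfold valueTensor maxPrefix boxSum
  congr 2
  funext M
  refine sum_congr ?_ fun _ _ => rfl
  ext s
  simp [initBox, Fintype.mem_piFinset]

/-- Summation undoes the discrete derivative. -/
lemma boxSum_diff (T : Tensor n Y) (S : (Z : Y) → Finset (Fin (n Z))) (Z : Y) (j : ℕ)
    (hj : j < n Z) : boxSum (diff Z T) (update S Z (initSeg (j + 1))) =
      boxSum T (update S Z {⟨j, hj⟩}) := by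
  induction j with
  | zero =>
    rw [initSeg_one ⟨0, hj⟩ rfl]
    refine sum_congr rfl fun t ht => ?_
    have : t Z = ⟨0, hj⟩ := by simpa using Fintype.mem_piFinset.1 ht Z
    simp [diff, this]
  | succ j ih =>
    rw [boxSum_update_eq_sum, sum_initSeg_succ hj, ← boxSum_update_eq_sum (diff Z T) S Z (initSeg (j + 1)),
      ih (by omega)]
    have : boxSum (diff Z T) (update S Z {⟨j + 1, hj⟩}) = boxSum T (update S Z {⟨j + 1, hj⟩}) -
        boxSum (fun t => T (update t Z ⟨j, by omega⟩)) (update S Z {⟨j + 1, hj⟩}) := by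
      unfold boxSum
      rw [← sum_sub_distrib]
      refine sum_congr rfl fun t ht => ?_
      have : t Z = ⟨j + 1, hj⟩ := by simpa using Fintype.mem_piFinset.1 ht Z
      simp [diff, this]
    rw [this, boxSum_update_singleton_shift]
    ring

/-- Differentiating along the variables in `A` and then summing along them up to `m`, with the other
coordinates fixed at `m`, gives back `T m`. -/
lemma boxSum_foldr_diff (T : Tensor n Y) (m : Tup n Y) (A : Finset Y) :
    boxSum (A.val.foldr diff T) (fun Z => if Z ∈ A then initSeg ((m Z : ℕ) + 1) else {m Z}) =
      T m := by
  induction A using Finset.induction_on with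
  | empty => simp [boxSum, Fintype.piFinset_singleton]
  | insert a A ha ih =>
    rw [insert_val_of_notMem ha, Multiset.foldr_cons]
    have e : (fun Z => if Z ∈ insert a A then initSeg ((m Z : ℕ) + 1) else {m Z} :
        (Z : Y) → Finset (Fin (n Z))) =
        update (fun Z => if Z ∈ A then initSeg ((m Z : ℕ) + 1) else {m Z}) a
          (initSeg ((m a : ℕ) + 1)) := by
      funext Z
      rcases eq_or_ne Z a with rfl | h <;> simp [*]
    rw [e, boxSum_diff _ _ _ _ (m a).2, ← ih]
    congr 1
    funext Z
    rcases eq_or_ne Z a with rfl | h <;> simp [*]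

lemma boxSum_worstCaseTensor_le (m : Tup n Y) :
    boxSum (worstCaseTensor f B) (initBox fun Z => (m Z : ℕ) + 1) = valueTensor f B m := by
  have := boxSum_foldr_diff (valueTensor f B) m univ
  simp only [mem_univ, if_true] at this
  exact this

lemma boxSum_worstCaseTensor (k : Y → ℕ) :
    boxSum (worstCaseTensor f B) (initBox k) = maxPrefix f B k := by
  by_cases hk : ∀ Z : Y, 0 < k Z ∧ 0 < n Z
  · let m : Tup n Y := fun Z => ⟨min (k Z) (n Z) - 1, by have := hk Z; omega⟩
    have e : (initBox k : (Z : Y) → Finset (Fin (n Z))) = initBox fun Z => (m Z : ℕ) + 1 := by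
      funext Z
      ext i
      have := hk Z
      have := i.2
      simp only [initBox, mem_initSeg, m]
      omega
    have h := boxSum_worstCaseTensor_le (f := f) (B := B) m
    rw [valueTensor_eq_maxPrefix] at h
    rw [e, h]
    unfold maxPrefix
    rw [e]
  · have e : Fintype.piFinset (initBox k : (Z : Y) → Finset (Fin (n Z))) = ∅ := by
      push Not at hk
      obtain ⟨Z, hZ⟩ := hk
      refine Fintype.piFinset_eq_empty.2 ⟨Z, ?_⟩
      ext i
      have := i.2
      simp only [initBox, mem_initSeg, notMem_empty, iff_false]
      by_contra h
      have := hZ (by omega)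
      omega
    by_cases hne : (ConsistentNonneg f B : Set (Tensor n Y)).Nonempty
    · simp [maxPrefix, boxSum, e, hne]
    · simp [maxPrefix, boxSum, e, Set.not_nonempty_iff_eq_empty.1 hne]

lemma boxSum_slice_worstCaseTensor (k : Y → ℕ) (Z : Y) (z : Fin (n Z)) :
    boxSum (worstCaseTensor f B) (update (initBox k) Z {z}) =
      maxPrefix f B (update k Z (z + 1)) - maxPrefix f B (update k Z z) := by
  rw [← boxSum_worstCaseTensor, ← boxSum_worstCaseTensor, initBox_update, initBox_update,
    boxSum_update_eq_sum _ _ _ (initSeg _), boxSum_update_eq_sum _ _ _ (initSeg _),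
    sum_initSeg_succ z.2]
  ring

/-! ### The worst-case tensor majorizes all permuted consistent tensors -/

/-- The increasing enumeration of `A`, as a map of `Fin m` whose values outside the first `#A`
indices are irrelevant; it never decreases an index. -/
lemma exists_sorting {m : ℕ} (A : Finset (Fin m)) : ∃ e : Fin m → Fin m,
    Set.InjOn e (initSeg #A : Finset (Fin m)) ∧ (initSeg #A).image e = A ∧
      ∀ i ∈ (initSeg #A : Finset (Fin m)), i ≤ e i := by
  have hA : #A ≤ m := by simpa using card_le_univ A
  let e₀ := A.orderEmbOfFin rfl
  have hle : ∀ (j : ℕ) (h : j < #A), j ≤ (e₀ ⟨j, h⟩ : ℕ) := by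
    intro j
    induction j with
    | zero => simp
    | succ j ih =>
      intro h
      have h1 := ih (by omega)
      have h2 : e₀ ⟨j, by omega⟩ < e₀ ⟨j + 1, h⟩ := e₀.strictMono (by simp [Fin.lt_def])
      rw [Fin.lt_def] at h2
      omega
  let e : Fin m → Fin m := fun i => if h : (i : ℕ) < #A then e₀ ⟨i, h⟩ else i
  have he : ∀ (i : Fin m) (h : (i : ℕ) < #A), e i = e₀ ⟨i, h⟩ := fun i h => by simp [e, h]
  have hinj : Set.InjOn e (initSeg #A : Finset (Fin m)) := by
    intro i hi j hj hij
    simp only [mem_coe, mem_initSeg] at hi hj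
    rw [he i hi, he j hj] at hij
    have := e₀.injective hij
    simpa [Fin.ext_iff] using this
  refine ⟨e, hinj, eq_of_subset_of_card_le ?_ ?_, ?_⟩
  · intro i hi
    obtain ⟨j, hj, rfl⟩ := mem_image.1 hi
    rw [he j (mem_initSeg.1 hj)]
    exact A.orderEmbOfFin_mem rfl _
  · rw [card_image_of_injOn hinj, card_initSeg hA]
  · intro i hi
    rw [he i (mem_initSeg.1 hi), Fin.le_def]
    exact hle _ _

lemma boxSum_comp {M : Tensor n Y} {A : (Z : Y) → Finset (Fin (n Z))}
    {e : (Z : Y) → Fin (n Z) → Fin (n Z)} (he : ∀ Z, Set.InjOn (e Z) (A Z)) :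
    boxSum (fun t => M fun Z => e Z (t Z)) A = boxSum M fun Z => (A Z).image (e Z) := by
  unfold boxSum
  rw [Fintype.piFinset_image, sum_image]
  intro s hs t ht hst
  funext Z
  exact he Z (Fintype.mem_piFinset.1 hs Z) (Fintype.mem_piFinset.1 ht Z) (congrFun hst Z)

/-- Moving the entries of a box to the origin, in the same order, keeps a tensor consistent
because the degree sequences are non-increasing. -/
lemma boxSum_le_maxPrefix (hY : Y.Nonempty) (hf : ∀ Z, IsDegreeSequence (f Z)) {M : Tensor n Y}
    (hM : M ∈ ConsistentNonneg f B) (A : (Z : Y) → Finset (Fin (n Z))) :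
    boxSum M A ≤ maxPrefix f B fun Z => #(A Z) := by
  choose e hinj himg hle using fun Z => exists_sorting (A Z)
  set K : (Z : Y) → Finset (Fin (n Z)) := initBox fun Z => #(A Z)
  have hinjK : ∀ Z, Set.InjOn (e Z) (K Z) := hinj
  let M' : Tensor n Y := fun t => if t ∈ Fintype.piFinset K then M fun Z => e Z (t Z) else 0
  have hM' : M' ∈ ConsistentNonneg f B := by
    refine ⟨fun t => ?_, fun Z i => ?_, fun t => ?_⟩
    · simp only [M']; split_ifs
      exacts [hM.1 _, le_rfl]
    · by_cases hi : i ∈ K Z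
      · have h1 : marginal M' Z i = boxSum (fun t => M fun Z => e Z (t Z)) (update K Z {i}) := by
          unfold marginal boxSum
          simp only [M']
          rw [← sum_filter]
          refine sum_congr ?_ fun _ _ => rfl
          ext t
          simp only [mem_filter, mem_univ, true_and, Fintype.mem_piFinset]
          constructor
          · rintro ⟨rfl, h⟩ W
            rcases eq_or_ne W Z with rfl | hW
            · simp
            · simpa [hW] using h W
          · intro h
            have hZ : t Z = i := by simpa using h Z
            refine ⟨hZ, fun W => ?_⟩
            rcases eq_or_ne W Z with rfl | hW
            · rwa [hZ]
            · simpa [hW] using h W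
        rw [h1, boxSum_comp]
        · refine le_trans ?_ ((hM.2.1 Z (e Z i)).trans ((hf Z).2 (hle Z i hi)))
          rw [marginal_eq_boxSum]
          refine boxSum_mono hM.1 fun W => ?_
          rcases eq_or_ne W Z with rfl | hW <;> simp [*]
        · intro W
          rcases eq_or_ne W Z with rfl | hW
          · simp
          · simpa [hW] using hinjK W
      · refine le_of_eq_of_le ?_ ((hf Z).1 i)
        refine sum_eq_zero fun t ht => if_neg fun h => hi ?_
        rw [← (mem_filter.1 ht).2]
        exact Fintype.mem_piFinset.1 h Z
    · simp only [M']; split_ifs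
      · exact hM.2.2 _
      · simp
  have h2 : boxSum M' K = boxSum M A := by
    have : boxSum M' K = boxSum (fun t => M fun Z => e Z (t Z)) K :=
      sum_congr rfl fun t ht => if_pos ht
    rw [this, boxSum_comp hinjK]
    congr 1
    funext Z
    exact himg Z
  rw [← h2]
  exact le_maxPrefix hY (fun Z => (hf Z).1) hM' _

lemma majorizes_worstCaseTensor (hY : Y.Nonempty) (hf : ∀ Z, IsDegreeSequence (f Z))
    {M : Tensor n Y} (hM : M ∈ ConsistentNonneg f B) (σ : (Z : Y) → Equiv.Perm (Fin (n Z))) :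
    Majorizes (worstCaseTensor f B) (permute M σ) := by
  intro S
  rw [boxSum_worstCaseTensor]
  unfold permute
  rw [boxSum_comp fun Z => (σ Z).injective.injOn]
  convert boxSum_le_maxPrefix hY hf hM _ using 3
  exact (card_image_of_injective _ (σ _).injective).symm

/-! ### The worst-case tensor is sorted -/

/-- The average of `M` and of the part of `M'` before `z`, cut off after the index `z + 1` of the
direction `Z`, and with the slice at `z + 1` merged into the slice at `z`. -/
noncomputable def mergeSlices (Z : Y) (z : ℕ) (hz : z + 1 < n Z) (M M' : Tensor n Y) :
    Tensor n Y :=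
  fun t => if (t Z : ℕ) < z then (M t + M' t) / 2
    else if (t Z : ℕ) = z then (M t + M (update t Z ⟨z + 1, hz⟩)) / 2 else 0

lemma boxSum_mergeSlices_slice (Z : Y) (z : ℕ) (hz : z + 1 < n Z) (M M' : Tensor n Y)
    (A : (Z : Y) → Finset (Fin (n Z))) (y : Fin (n Z)) :
    boxSum (mergeSlices Z z hz M M') (update A Z {y}) =
      if (y : ℕ) < z then (boxSum M (update A Z {y}) + boxSum M' (update A Z {y})) / 2
      else if (y : ℕ) = z then
        (boxSum M (update A Z {y}) + boxSum M (update A Z {⟨z + 1, hz⟩})) / 2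
      else 0 := by
  rw [← boxSum_update_singleton_shift M A Z y ⟨z + 1, hz⟩]
  have hy : ∀ t ∈ Fintype.piFinset (update A Z {y}), t Z = y := fun t ht => by
    simpa using Fintype.mem_piFinset.1 ht Z
  unfold boxSum
  split_ifs with h1 h2
  · rw [← sum_add_distrib, sum_div]
    exact sum_congr rfl fun t ht => by simp [mergeSlices, hy t ht, h1]
  · rw [← sum_add_distrib, sum_div]
    exact sum_congr rfl fun t ht => by simp [mergeSlices, hy t ht, h2]
  · exact sum_eq_zero fun t ht => by simp [mergeSlices, hy t ht, h1, h2]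

lemma boxSum_mergeSlices (Z : Y) (z : ℕ) (hz : z + 1 < n Z) (M M' : Tensor n Y)
    (A : (Z : Y) → Finset (Fin (n Z))) (j : ℕ) (hj : z < j) (hA : A Z = initSeg j) :
    boxSum (mergeSlices Z z hz M M') A =
      (boxSum M (update A Z (initSeg (z + 2))) + boxSum M' (update A Z (initSeg z))) / 2 := by
  have hlt : ∀ y ∈ (initSeg z : Finset (Fin (n Z))), (y : ℕ) < z := fun y hy => mem_initSeg.1 hy
  rw [boxSum_eq_sum_slice _ _ Z, hA]
  have hsub : (initSeg (z + 1) : Finset (Fin (n Z))) ⊆ initSeg j := fun y hy =>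
    mem_initSeg.2 (by have := mem_initSeg.1 hy; omega)
  rw [← sum_subset hsub fun y _ hy => by
    have : ¬ (y : ℕ) < z + 1 := fun h => hy (mem_initSeg.2 h)
    rw [boxSum_mergeSlices_slice, if_neg (by omega), if_neg (by omega)]]
  rw [sum_initSeg_succ (by omega), boxSum_mergeSlices_slice,
    boxSum_update_eq_sum M A Z (initSeg _), boxSum_update_eq_sum M' A Z (initSeg _), sum_initSeg_succ hz, sum_initSeg_succ (by omega : z < n Z),
    sum_congr rfl fun y hy => by rw [boxSum_mergeSlices_slice, if_pos (hlt y hy)]]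
  rw [← sum_div, sum_add_distrib]
  simp only [lt_irrefl, if_false, if_true]
  ring

lemma ofReal_half_add_le {a b : ℝ} (hB : ENNReal.ofReal a ≤ B)
    (hB' : ENNReal.ofReal b ≤ B) : ENNReal.ofReal ((a + b) / 2) ≤ B := by
  rcases le_total a b with h | h
  · exact (ENNReal.ofReal_le_ofReal (by linarith)).trans hB'
  · exact (ENNReal.ofReal_le_ofReal (by linarith)).trans hB

lemma mergeSlices_mem (hf : ∀ Z, IsDegreeSequence (f Z)) (Z : Y) (z : ℕ) (hz : z + 1 < n Z)
    {M M' : Tensor n Y} (hM : M ∈ ConsistentNonneg f B) (hM' : M' ∈ ConsistentNonneg f B) :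
    mergeSlices Z z hz M M' ∈ ConsistentNonneg f B := by
  refine ⟨fun t => ?_, fun W i => ?_, fun t => ?_⟩
  · unfold mergeSlices
    have := hM.1 t
    have := hM'.1 t
    have := hM.1 (update t Z ⟨z + 1, hz⟩)
    split_ifs <;> positivity
  · rcases eq_or_ne W Z with rfl | hW
    · rw [marginal_eq_boxSum, boxSum_mergeSlices_slice, ← marginal_eq_boxSum,
        ← marginal_eq_boxSum, ← marginal_eq_boxSum]
      have h1 := hM.2.1 W i
      have h2 := hM'.2.1 W i
      have h3 := hM.2.1 W ⟨z + 1, hz⟩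
      split_ifs with h h'
      · linarith
      · have : f W ⟨z + 1, hz⟩ ≤ f W i := (hf W).2 (by rw [Fin.le_def]; simp [h'])
        linarith
      · exact (hf W).1 i
    · have h1 := hM.2.1 W i
      have h2 := hM'.2.1 W i
      rw [marginal_eq_boxSum] at h1 h2 ⊢
      rw [boxSum_mergeSlices Z z hz M M' _ (n Z) (by omega)
        (by rw [update_of_ne hW.symm, initSeg_of_le le_rfl])]
      have hsub : ∀ j, ∀ V, update (update (fun _ => univ) W {i} :
          (Z : Y) → Finset (Fin (n Z))) Z (initSeg j) V ⊆
            (update (fun _ => univ) W {i} : (Z : Y) → Finset (Fin (n Z))) V := by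
        intro j V
        rcases eq_or_ne V Z with rfl | hV
        · simp [hW.symm]
        · simp [hV]
      have h3 := boxSum_mono hM.1 (hsub (z + 2))
      have h4 := boxSum_mono hM'.1 (hsub z)
      linarith
  · unfold mergeSlices
    split_ifs
    · exact ofReal_half_add_le (hM.2.2 _) (hM'.2.2 _)
    · exact ofReal_half_add_le (hM.2.2 _) (hM.2.2 _)
    · simp

/-- The value tensor is concave in each direction. -/
lemma maxPrefix_concave (hY : Y.Nonempty) (hf : ∀ Z, IsDegreeSequence (f Z)) (k : Y → ℕ) (Z : Y)
    (z : ℕ) (hz : z + 1 < n Z) :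
    maxPrefix f B (update k Z (z + 2)) + maxPrefix f B (update k Z z) ≤
      2 * maxPrefix f B (update k Z (z + 1)) := by
  have hf0 : ∀ Z i, 0 ≤ f Z i := fun Z => (hf Z).1
  rw [← le_sub_iff_add_le]
  refine maxPrefix_le hf0 fun M hM => ?_
  rw [le_sub_comm]
  refine maxPrefix_le hf0 fun M' hM' => ?_
  have h := le_maxPrefix hY hf0 (mergeSlices_mem hf Z z hz hM hM') (update k Z (z + 1))
  rw [boxSum_mergeSlices Z z hz M M' _ (z + 1) (by omega) (by simp [initBox]), initBox_update,
    update_idem, update_idem, ← initBox_update, ← initBox_update] at h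
  linarith

lemma antitone_of_succ_le {m : ℕ} {g : Fin m → ℝ}
    (h : ∀ (z : ℕ) (hz : z + 1 < m), g ⟨z + 1, hz⟩ ≤ g ⟨z, by omega⟩) : Antitone g := by
  have key : ∀ (a d : ℕ) (hd : a + d < m), g ⟨a + d, hd⟩ ≤ g ⟨a, by omega⟩ := by
    intro a d
    induction d with
    | zero => intro _; exact le_rfl
    | succ d ih => intro hd; exact (h (a + d) hd).trans (ih _)
  intro i j hij
  rw [Fin.le_def] at hij
  have e : (⟨i + (j - i), by omega⟩ : Fin m) = j := Fin.ext (Nat.add_sub_cancel' hij)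
  rw [← e]
  exact key i (j - i) _

lemma isSorted_worstCaseTensor (hY : Y.Nonempty) (hf : ∀ Z, IsDegreeSequence (f Z)) :
    IsSorted (worstCaseTensor f B) := by
  intro k Z
  simp only [boxSum_slice_worstCaseTensor]
  refine ⟨fun z => sub_nonneg.2 (maxPrefix_mono hY (fun Z => (hf Z).1) ?_),
    antitone_of_succ_le fun z hz => ?_⟩
  · rw [update_le_update_iff]
    exact ⟨by omega, fun _ _ => le_rfl⟩
  · have := maxPrefix_concave (B := B) hY hf k Z z hz
    simp only
    linarith

end Value

/-! ### The worst-case tensor without a bound on the multiplicities -/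

section Unbounded

open MeasureTheory

variable {Var : Type*} {n : Var → ℕ} {Y : Finset Var}
  {f : (Z : Y) → Fin (n Z) → ℝ}

/-- The interval of length `f Z i` that lies between consecutive partial sums of `f Z`. -/
def stepInterval (f : (Z : Y) → Fin (n Z) → ℝ) (Z : Y) (i : Fin (n Z)) : Set ℝ :=
  Set.Ico (∑ j ∈ initSeg i, f Z j) (∑ j ∈ initSeg (i + 1), f Z j)

/-- The tensor whose entry at `t` is the length of the intersection over `Z` of the intervals
between the partial sums of `f Z` up to `t Z - 1` and up to `t Z`. -/
noncomputable def overlapTensor (f : (Z : Y) → Fin (n Z) → ℝ) : Tensor n Y :=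
  fun t => volume.real (⋂ Z, stepInterval f Z (t Z))

lemma monotone_sum_initSeg (hf : ∀ Z i, 0 ≤ f Z i) (Z : Y) :
    Monotone fun k => ∑ j ∈ initSeg k, f Z j := fun _ _ h =>
  sum_le_sum_of_subset_of_nonneg
    (fun _ hi => mem_initSeg.2 ((mem_initSeg.1 hi).trans_le h)) fun i _ _ => hf Z i

lemma stepInterval_unique (hf : ∀ Z i, 0 ≤ f Z i) {Z : Y} {i j : Fin (n Z)} {r : ℝ}
    (hi : r ∈ stepInterval f Z i) (hj : r ∈ stepInterval f Z j) : i = j := by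
  have hm := monotone_sum_initSeg hf Z
  have aux : ∀ {i j : Fin (n Z)}, r ∈ stepInterval f Z i → r ∈ stepInterval f Z j → ¬ i < j := by
    intro i j hi hj h
    have : (i : ℕ) + 1 ≤ j := h
    exact absurd (hi.2.trans_le (hm this)) (not_lt.2 hj.1)
  exact le_antisymm (not_lt.1 (aux hj hi)) (not_lt.1 (aux hi hj))

lemma exists_mem_stepInterval {Z : Y} {k : ℕ} {r : ℝ}
    (h0 : 0 ≤ r) (hr : r < ∑ j ∈ initSeg k, f Z j) :
    ∃ i : Fin (n Z), (i : ℕ) < k ∧ r ∈ stepInterval f Z i := by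
  induction k with
  | zero => simp only [initSeg_zero, sum_empty] at hr; exact absurd hr (not_lt.2 h0)
  | succ k ih =>
    by_cases h : r < ∑ j ∈ initSeg k, f Z j
    · obtain ⟨i, hi, hir⟩ := ih h
      exact ⟨i, by omega, hir⟩
    · have hk : k < n Z := by
        by_contra hk
        rw [initSeg_of_le (by omega : n Z ≤ k + 1)] at hr
        rw [initSeg_of_le (by omega : n Z ≤ k)] at h
        exact h hr
      exact ⟨⟨k, hk⟩, by simp, not_lt.1 h, hr⟩

variable [DecidableEq Var]

lemma boxSum_overlapTensor_eq_volume (hY : Y.Nonempty) (hf : ∀ Z i, 0 ≤ f Z i)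
    (A : (Z : Y) → Finset (Fin (n Z))) : boxSum (overlapTensor f) A =
      volume.real (⋃ t ∈ Fintype.piFinset A, ⋂ Z, stepInterval f Z (t Z)) := by
  obtain ⟨Z₀, hZ₀⟩ := hY
  refine (measureReal_biUnion_finset ?_ ?_ ?_).symm
  · intro s _ t _ hst
    rw [Function.onFun, Set.disjoint_left]
    intro r hs ht
    exact hst (funext fun Z =>
      stepInterval_unique hf (Set.mem_iInter.1 hs Z) (Set.mem_iInter.1 ht Z))
  · exact fun t _ => MeasurableSet.iInter fun Z => measurableSet_Ico
  · intro t _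
    exact ne_top_of_le_ne_top (by rw [stepInterval, Real.volume_Ico]; exact ENNReal.ofReal_ne_top)
      (measure_mono (Set.iInter_subset _ ⟨Z₀, hZ₀⟩))

lemma overlapTensor_mem (hY : Y.Nonempty) (hf : ∀ Z i, 0 ≤ f Z i) :
    overlapTensor f ∈ ConsistentNonneg f ⊤ := by
  refine ⟨fun t => measureReal_nonneg, fun Z i => ?_, fun t => le_top⟩
  rw [marginal_eq_boxSum, boxSum_overlapTensor_eq_volume hY hf]
  have hi : f Z i = volume.real (stepInterval f Z i) := by
    rw [stepInterval, Real.volume_real_Ico, sum_initSeg_succ i.2]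
    simp [hf Z i]
  rw [hi]
  refine measureReal_mono ?_ ?_
  · refine Set.iUnion₂_subset fun t ht => ?_
    have : t Z = i := by simpa using Fintype.mem_piFinset.1 ht Z
    rw [← this]
    exact Set.iInter_subset _ Z
  · rw [stepInterval, Real.volume_Ico]; exact ENNReal.ofReal_ne_top

lemma boxSum_overlapTensor (hY : Y.Nonempty) (hf : ∀ Z i, 0 ≤ f Z i) (k : Y → ℕ) :
    boxSum (overlapTensor f) (initBox k) =
      volume.real (⋂ Z, Set.Ico 0 (∑ i ∈ initSeg (k Z), f Z i)) := by
  rw [boxSum_overlapTensor_eq_volume hY hf]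
  congr 1
  ext r
  simp only [Set.mem_iUnion, Set.mem_iInter, exists_prop, Fintype.mem_piFinset]
  constructor
  · rintro ⟨t, ht, h⟩ Z
    refine ⟨le_trans (sum_nonneg fun i _ => hf Z i) (h Z).1, (h Z).2.trans_le ?_⟩
    exact monotone_sum_initSeg hf Z (mem_initSeg.1 (ht Z))
  · intro h
    choose t ht htr using fun Z => exists_mem_stepInterval (h Z).1 (h Z).2
    exact ⟨t, fun Z => mem_initSeg.2 (ht Z), htr⟩

/-- The overlap tensor attains the value tensor simultaneously on all initial boxes. -/
lemma maxPrefix_top (hY : Y.Nonempty) (hf : ∀ Z i, 0 ≤ f Z i) (k : Y → ℕ) :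
    maxPrefix f ⊤ k = boxSum (overlapTensor f) (initBox k) := by
  refine le_antisymm (maxPrefix_le hf fun M hM => ?_)
    (le_maxPrefix hY hf (overlapTensor_mem hY hf) k)
  have h0 := boxSum_nonneg hM.1 (initBox k)
  have h : boxSum M (initBox k) = volume.real (Set.Ico 0 (boxSum M (initBox k))) := by
    rw [Real.volume_real_Ico]; simp [h0]
  rw [boxSum_overlapTensor hY hf, h]
  obtain ⟨Z₀, hZ₀⟩ := hY
  refine measureReal_mono (Set.subset_iInter fun Z r hr => ⟨hr.1, hr.2.trans_le ?_⟩) ?_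
  · exact boxSum_le_sum_of_consistent hM Z _
  · exact ne_top_of_le_ne_top (by rw [Real.volume_Ico]; exact ENNReal.ofReal_ne_top)
      (measure_mono (Set.iInter_subset _ ⟨Z₀, hZ₀⟩))

/-- A tensor is determined by its sums over origin-anchored boxes. -/
lemma eq_of_boxSum_initBox_eq {T T' : Tensor n Y}
    (h : ∀ k, boxSum T (initBox k) = boxSum T' (initBox k)) : T = T' := by
  funext t
  induction t using WellFoundedLT.induction with
  | ind t ih =>
    have hk := h fun Z => (t Z : ℕ) + 1
    have ht : t ∈ Fintype.piFinset (initBox (fun Z => (t Z : ℕ) + 1) :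
        (Z : Y) → Finset (Fin (n Z))) := Fintype.mem_piFinset.2 fun Z => by simp [initBox]
    unfold boxSum at hk
    rw [← add_sum_erase _ _ ht, ← add_sum_erase _ _ ht,
      sum_congr rfl fun s hs => ih s ?_] at hk
    · exact add_right_cancel hk
    · obtain ⟨hst, hs⟩ := mem_erase.1 hs
      refine lt_of_le_of_ne (fun Z => ?_) hst
      have := Fintype.mem_piFinset.1 hs Z
      simp only [initBox, mem_initSeg] at this
      rw [Fin.le_def]
      omega

lemma worstCaseTensor_top (hY : Y.Nonempty) (hf : ∀ Z i, 0 ≤ f Z i) :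
    worstCaseTensor f ⊤ = overlapTensor f :=
  eq_of_boxSum_initBox_eq fun k => by rw [boxSum_worstCaseTensor, maxPrefix_top hY hf]

end Unbounded

/-! ### Acyclic queries -/

/-- In a finite acyclic graph there is no non-empty set of vertices all of which have two
neighbours in the set: paths could be prolonged indefinitely. -/
lemma exists_forall_adj_eq_of_isAcyclic {V : Type*} [Fintype V]
    {G : SimpleGraph V} (hG : G.IsAcyclic) {S : Set V} (hS : S.Nonempty) :
    ∃ v ∈ S, ∃ u, ∀ w ∈ S, G.Adj v w → w = u := by
  by_contra! hcon
  have key : ∀ l : ℕ, ∃ u ∈ S, ∃ (v : V) (p : G.Walk u v), p.IsPath ∧ p.length = l := by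
    intro l
    induction l with
    | zero =>
      obtain ⟨v, hv⟩ := hS
      exact ⟨v, hv, v, .nil, .nil, rfl⟩
    | succ l ih =>
      obtain ⟨u, hu, v, p, hp, rfl⟩ := ih
      obtain ⟨w, hw, huw, hne⟩ := hcon u hu p.snd
      refine ⟨w, hw, v, .cons huw.symm p, hp.cons fun hmem => hne ?_, rfl⟩
      exact hG.eq_snd_of_adj_start hp huw hmem
  obtain ⟨u, -, v, p, hp, hl⟩ := key (Fintype.card V)
  exact absurd hp.length_lt (by omega)

variable {Rel Var : Type*}

/-- Every non-empty set of relations of a Berge-acyclic query contains one that shares at most one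
variable with the others. -/
lemma Query.BergeAcyclic.exists_ear [Fintype Rel] [Fintype Var] {Q : Query Rel Var} (hQ : Q.BergeAcyclic)
    (hvars : ∀ R, (Q.vars R).Nonempty) {s : Finset Rel} (hs : s.Nonempty) :
    ∃ R ∈ s, ∃ Z, ∀ R' ∈ s, R' ≠ R → ∀ W ∈ Q.vars R, W ∈ Q.vars R' → W = Z := by
  by_contra! hcon
  obtain ⟨R₀, hR₀⟩ := hs
  -- the relations in `s` and the variables shared by two of them
  let S : Set (Rel ⊕ Var) := {x | match x with
    | .inl R => R ∈ s
    | .inr Z => ∃ R ∈ s, ∃ R' ∈ s, R' ≠ R ∧ Z ∈ Q.vars R ∧ Z ∈ Q.vars R'}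
  obtain ⟨v, hv, u, hu⟩ := exists_forall_adj_eq_of_isAcyclic hQ
    (S := S) ⟨.inl R₀, hR₀⟩
  rcases v with R | Z
  · have aux : ∀ Z, ∃ W, W ≠ Z ∧ u = .inr W := by
      intro Z
      obtain ⟨R', hR', hne, W, hW, hW', hWZ⟩ := hcon R hv Z
      exact ⟨W, hWZ, (hu (.inr W) ⟨R, hv, R', hR', hne, hW, hW'⟩ hW).symm⟩
    obtain ⟨Z₀, -⟩ := hvars R
    obtain ⟨W, -, hW⟩ := aux Z₀
    obtain ⟨W', hne, hW'⟩ := aux W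
    exact hne (Sum.inr_injective (hW'.symm.trans hW))
  · obtain ⟨R, hR, R', hR', hne, hZ, hZ'⟩ := hv
    have h1 := hu (.inl R) hR hZ
    have h2 := hu (.inl R') hR' hZ'
    exact hne (Sum.inl_injective (h2.trans h1.symm))

lemma dependsOn_prod_extend (Q : Query Rel Var) {n : Var → ℕ}
    (T : (R : Rel) → Tensor n (Q.vars R)) (s : Finset Rel) :
    DependsOn (fun x => ∏ R ∈ s, extend (T R) x) {Z | ∃ R ∈ s, Z ∈ Q.vars R} :=
  fun _ _ h => prod_congr rfl fun R hR => dependsOn_extend (T R) fun Z hZ => h Z ⟨R, hR, hZ⟩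

variable [Fintype Rel] [Fintype Var] [DecidableEq Var]

/-- Joining the relations along an ear decomposition, majorization by sorted tensors passes from
the relations to the whole query. -/
lemma isSorted_and_majorizes_prod {Q : Query Rel Var} (hQ : Q.BergeAcyclic)
    (hvars : ∀ R, (Q.vars R).Nonempty) {n : Var → ℕ} {T C : (R : Rel) → Tensor n (Q.vars R)}
    (hT : ∀ R t, 0 ≤ T R t) (hC : ∀ R, IsSorted (C R)) (hTC : ∀ R, Majorizes (C R) (T R))
    (s : Finset Rel) : IsSorted (fun x => ∏ R ∈ s, extend (C R) x) ∧
      Majorizes (fun x => ∏ R ∈ s, extend (C R) x) (fun x => ∏ R ∈ s, extend (T R) x) := by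
  classical
  induction s using Finset.strongInduction with
  | H s ih =>
    rcases s.eq_empty_or_nonempty with rfl | hs
    · simpa using ⟨isSorted_one, majorizes_one⟩
    · obtain ⟨R, hR, Z, hZ⟩ := hQ.exists_ear hvars hs
      obtain ⟨h1, h2⟩ := ih (s.erase R) (erase_ssubset hR)
      have hY : (Q.vars R : Set Var) ∩ {Z | ∃ R' ∈ s.erase R, Z ∈ Q.vars R'} ⊆ {Z} := by
        rintro W ⟨hW, R', hR', hW'⟩
        exact hZ R' (mem_of_mem_erase hR') (ne_of_mem_erase hR') W hW hW'
      simp only [← mul_prod_erase s _ hR]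
      exact ⟨((hC R).extend (hvars R)).mul (dependsOn_extend _) (dependsOn_prod_extend Q C _) hY
          h1,
        (hTC R).extend.mul (dependsOn_extend _) (dependsOn_prod_extend Q T _)
          (dependsOn_extend _) (dependsOn_prod_extend Q C _) hY
          (fun x => prod_nonneg fun R' _ => hT R' _) ((hC R).extend (hvars R)) h2⟩

lemma outputSize_le_of_majorizes {Q : Query Rel Var} (hQ : Q.BergeAcyclic)
    (hvars : ∀ R, (Q.vars R).Nonempty) {n : Var → ℕ} {T C : (R : Rel) → Tensor n (Q.vars R)}
    (hT : ∀ R t, 0 ≤ T R t) (hC : ∀ R, IsSorted (C R)) (hTC : ∀ R, Majorizes (C R) (T R)) :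
    Q.outputSize T ≤ Q.outputSize C := by
  have h := (isSorted_and_majorizes_prod hQ hvars hT hC hTC univ).2 fun _ => univ
  have e : (initBox fun Z => #(univ : Finset (Fin (n Z)))) =
      fun Z => (univ : Finset (Fin (n Z))) := by
    funext Z
    exact initSeg_of_le (by simp)
  rw [e] at h
  simp only [boxSum, Fintype.piFinset_univ] at h
  exact h

end DegreeSequenceBound

theorem theorem4p1 {Rel Var : Type*} [Fintype Rel] [Fintype Var] [DecidableEq Var]
    (Q : DegreeSequenceBound.Query Rel Var)
    (hQ : Q.BergeAcyclic)
    (hvars : ∀ R, (Q.vars R).Nonempty)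
    (n : Var → ℕ)
    (f : (R : Rel) → (Z : Q.vars R) → Fin (n Z) → ℝ)
    (hf : ∀ R Z, DegreeSequenceBound.IsDegreeSequence (f R Z))
    (B : Rel → ENNReal) :
    (∀ (M : (R : Rel) → DegreeSequenceBound.Tensor n (Q.vars R))
        (σ : (R : Rel) → (Z : Q.vars R) → Equiv.Perm (Fin (n Z))),
        (∀ R, M R ∈ DegreeSequenceBound.ConsistentNonneg (f R) (B R)) →
        Q.outputSize (fun R => DegreeSequenceBound.permute (M R) (σ R)) ≤ Q.DSB f B) ∧
    ((∀ R, B R = ⊤) →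
      (∀ R, DegreeSequenceBound.worstCaseTensor (f R) (B R) ∈
        DegreeSequenceBound.ConsistentNonneg (f R) (B R)) ∧
      ∃ (M : (R : Rel) → DegreeSequenceBound.Tensor n (Q.vars R))
        (σ : (R : Rel) → (Z : Q.vars R) → Equiv.Perm (Fin (n Z))),
        (∀ R, M R ∈ DegreeSequenceBound.ConsistentNonneg (f R) (B R)) ∧
        Q.outputSize (fun R => DegreeSequenceBound.permute (M R) (σ R)) = Q.DSB f B) := by
  refine ⟨fun M σ hM => ?_, fun hB => ?_⟩
  · exact DegreeSequenceBound.outputSize_le_of_majorizes hQ hvars (fun R t => (hM R).1 _)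
      (fun R => DegreeSequenceBound.isSorted_worstCaseTensor (hvars R) (hf R))
      (fun R => DegreeSequenceBound.majorizes_worstCaseTensor (hvars R) (hf R) (hM R) (σ R))
  · -- the worst-case tensors, unpermuted, attain the bound
    have hC : ∀ R, DegreeSequenceBound.worstCaseTensor (f R) (B R) ∈
        DegreeSequenceBound.ConsistentNonneg (f R) (B R) := by
      intro R
      have hf0 : ∀ Z i, 0 ≤ f R Z i := fun Z => (hf R Z).1
      rw [hB R, DegreeSequenceBound.worstCaseTensor_top (hvars R) hf0]
      exact DegreeSequenceBound.overlapTensor_mem (hvars R) hf0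
    exact ⟨hC, fun R => DegreeSequenceBound.worstCaseTensor (f R) (B R), fun _ _ => 1, hC, rfl⟩
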